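/- **Model.** An environment $U$ is an $N\times N$ grid of cells with intensities in $[0,1]$, its coordinates being taken modulo $N$ (a torus). Let $n$ be a power of $2$ and $k\ge 1$ an integer with $n2^k\le N$. For $0\le \ell\le k-1$ and a cell $(i,j)$, the image of scale $\ell$ at location $(i,j)$ is the $n\times n$ array of pixels whose pixel $(s,t)$, $0\le s,t<n$, has as its value $x_{(s,t)}$ the average intensity of the $2^\ell\times 2^\ell$ square of cells $(i+s2^\ell+u,\;j+t2^\ell+v)$, $0\le u,v<2^\ell$ (coordinates modulo $N$). For an $n\times n$ image $I$ let $E$ be the set of unordered pairs of (horizontally or vertically) adjacent pixels, and for $r\in\{1,2\}$ put $$LD_r(I)=\frac1{|E|}\sum_{\{p,q\}\in E}|x_p-x_q|^r,\qquad GD_r(I)=\frac1{n^4}\sum_{p,q}|x_p-x_q|^r,$$ the last sum being over all ordered pairs of pixels, including $p=q$. Let $LD_r(\ell)$ and $GD_r(\ell)$ be the averages of $LD_r(I)$ and $GD_r(I)$ over the images $I$ of scale $\ell$ at all $N^2$ locations, and let $LD_r(U,k)$ be the expectation of $LD_r(I)$ when the scale of $I$ is uniform in $\{0,\dots,k-1\}$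 and its location is independent and uniform. Logarithms are to base $2$. **Theorem.** Let $1<\alpha<\frac{\log n}{2}$ and suppose that $GD_2(\ell)\le\alpha\, LD_2(\ell)$ for every $0\le\ell\le k-1$. There is exactly one $p$ with $0<p<1$ and $\frac{1-p^{\log n}}{1-p}=2\alpha$, and for this $p$ $$\sum_{\ell=0}^{k-1}LD_1(\ell)\le\frac{1+\sqrt p}{\sqrt{1-p}},\qquad\text{hence}\qquad LD_1(U,k)\le\frac1k\cdot\frac{1+\sqrt p}{\sqrt{1-p}}.$$ Moreover, for fixed $\alpha>1$ and $k$, as $n$ grows through the powers of $2$, the upper bound $\frac1k\cdot\frac{1+\sqrt p}{\sqrt{1-p}}$ on $LD_1(U,k)$ (where $p=p(n)$) tends to $\frac{\sqrt{2\alpha}+\sqrt{2\alpha-1}}{k}$. -/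

import Mathlib

open Finset Filter Topology

namespace ImageModel

noncomputable section

/-- An image with `n` rows and `m` columns: an array of pixels whose values lie in `[0,1]`. -/
structure Image (n m : ℕ) where
  value : Fin n × Fin m → ℝ
  value_mem : ∀ p, value p ∈ Set.Icc (0 : ℝ) 1

/-- Two pixels are adjacent if they are consecutive in a row or consecutive in a column. -/
def Adjacent {n m : ℕ} (p q : Fin n × Fin m) : Prop :=
  (p.1 = q.1 ∧ ((p.2 : ℕ) + 1 = q.2 ∨ (q.2 : ℕ) + 1 = p.2)) ∨
  (p.2 = q.2 ∧ ((p.1 : ℕ) + 1 = q.1 ∨ (q.1 : ℕ) + 1 = p.1))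

instance {n m : ℕ} (p q : Fin n × Fin m) : Decidable (Adjacent p q) := by
  unfold Adjacent; infer_instance

/-- The set `E` of edges: every unordered pair of adjacent pixels is listed exactly once, as the
ordered pair whose second pixel is to the right of, or below, the first one. -/
def edges (n m : ℕ) : Finset ((Fin n × Fin m) × (Fin n × Fin m)) :=
  univ.filter fun e => Adjacent e.1 e.2 ∧ e.1 ≤ e.2

theorem mem_edges {n m : ℕ} (p q : Fin n × Fin m) :
    (p, q) ∈ edges n m ↔ Adjacent p q ∧ p ≤ q := by
  simp [edges]

/-- Every unordered adjacent pair occurs among the edges, in exactly one of its two orders. -/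
theorem adjacent_iff {n m : ℕ} (p q : Fin n × Fin m) :
    Adjacent p q ↔ ((p, q) ∈ edges n m ∧ (q, p) ∉ edges n m) ∨
      ((q, p) ∈ edges n m ∧ (p, q) ∉ edges n m) := by
  obtain ⟨⟨a, ha⟩, ⟨b, hb⟩⟩ := p
  obtain ⟨⟨c, hc⟩, ⟨d, hd⟩⟩ := q
  simp only [mem_edges, Adjacent, Prod.mk_le_mk, Fin.mk_le_mk, Fin.mk.injEq]
  omega

/-- The local discrepancy `LD_r(I)`: the average of `|x_p - x_q| ^ r` over the edges. -/
def localDisc (r : ℕ) {n m : ℕ} (I : Image n m) : ℝ :=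
  (1 / (#(edges n m) : ℝ)) * ∑ e ∈ edges n m, |I.value e.1 - I.value e.2| ^ r

/-- The global discrepancy `GD_r(I)`: the average of `|x_p - x_q| ^ r` over all ordered pairs of
pixels, including the pairs with `p = q`. -/
def globalDisc (r : ℕ) {n m : ℕ} (I : Image n m) : ℝ :=
  (1 / ((n : ℝ) ^ 2 * (m : ℝ) ^ 2)) *
    ∑ p : Fin n × Fin m, ∑ q : Fin n × Fin m, |I.value p - I.value q| ^ r

/-- An environment: an `N` by `N` grid of cells with intensities in `[0,1]`, the cells being
indexed modulo `N` (the grid is treated as a torus). -/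
structure Environment (N : ℕ) where
  intensity : ZMod N → ZMod N → ℝ
  intensity_mem : ∀ i j, intensity i j ∈ Set.Icc (0 : ℝ) 1

/-- The average intensity of the `2 ^ ℓ` by `2 ^ ℓ` square of cells whose corner is `(i, j)`. -/
def pixelValue {N : ℕ} (U : Environment N) (ℓ : ℕ) (i j : ZMod N) : ℝ :=
  (1 / (2 : ℝ) ^ (2 * ℓ)) *
    ∑ u ∈ range (2 ^ ℓ), ∑ v ∈ range (2 ^ ℓ), U.intensity (i + (u : ZMod N)) (j + (v : ZMod N))

theorem pixelValue_mem {N : ℕ} (U : Environment N) (ℓ : ℕ) (i j : ZMod N) :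
    pixelValue U ℓ i j ∈ Set.Icc (0 : ℝ) 1 := by
  constructor
  · exact mul_nonneg (by positivity)
      (sum_nonneg fun u _ => sum_nonneg fun v _ => (U.intensity_mem _ _).1)
  · have h : ∑ u ∈ range (2 ^ ℓ), ∑ v ∈ range (2 ^ ℓ),
        U.intensity (i + (u : ZMod N)) (j + (v : ZMod N)) ≤
        ∑ u ∈ range (2 ^ ℓ), ∑ v ∈ range (2 ^ ℓ), (1 : ℝ) :=
      sum_le_sum fun u _ => sum_le_sum fun v _ => (U.intensity_mem _ _).2
    have h2 : ∑ u ∈ range (2 ^ ℓ), ∑ v ∈ range (2 ^ ℓ), (1 : ℝ) = (2 : ℝ) ^ (2 * ℓ) := by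
      simp only [sum_const, card_range, nsmul_eq_mul, mul_one, Nat.cast_pow, Nat.cast_ofNat]
      ring
    rw [h2] at h
    unfold pixelValue
    rw [one_div, inv_mul_le_iff₀ (by positivity)]
    simpa using h

/-- The `n` by `n` image of scale `ℓ` at location `(i, j)`: its pixel `(s, t)` represents the
`2 ^ ℓ` by `2 ^ ℓ` square of cells with corner `(i + s * 2 ^ ℓ, j + t * 2 ^ ℓ)` (modulo `N`). -/
def imageAt {N : ℕ} (U : Environment N) (n ℓ : ℕ) (i j : ZMod N) : Image n n where
  value p := pixelValue U ℓ (i + ((p.1 : ℕ) * 2 ^ ℓ : ℕ)) (j + ((p.2 : ℕ) * 2 ^ ℓ : ℕ))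
  value_mem _ := pixelValue_mem U ℓ _ _

/-- `LD_r(ℓ)`: the expected local discrepancy of an `n` by `n` image of scale `ℓ` at a uniformly
random location. -/
def scaleLD (r : ℕ) {N : ℕ} [NeZero N] (U : Environment N) (n ℓ : ℕ) : ℝ :=
  (1 / (N : ℝ) ^ 2) * ∑ i : ZMod N, ∑ j : ZMod N, localDisc r (imageAt U n ℓ i j)

/-- `GD_r(ℓ)`: the expected global discrepancy of an `n` by `n` image of scale `ℓ` at a uniformly
random location. -/
def scaleGD (r : ℕ) {N : ℕ} [NeZero N] (U : Environment N) (n ℓ : ℕ) : ℝ :=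
  (1 / (N : ℝ) ^ 2) * ∑ i : ZMod N, ∑ j : ZMod N, globalDisc r (imageAt U n ℓ i j)

/-- `LD_r(U, k)`: the expected local discrepancy of an `n` by `n` image whose scale in
`{0, …, k - 1}` and whose location are uniformly random and independent. -/
def avgLD (r : ℕ) {N : ℕ} [NeZero N] (U : Environment N) (n k : ℕ) : ℝ :=
  (1 / ((k : ℝ) * (N : ℝ) ^ 2)) *
    ∑ ℓ ∈ range k, ∑ i : ZMod N, ∑ j : ZMod N, localDisc r (imageAt U n ℓ i j)

end

end ImageModel

open ImageModel

/-! The proof rests on the mean square `S ℓ` (`meanSq`) of the pixel values of scale `ℓ` over all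
locations. A pixel of scale `ℓ + L` is the mean of a `2 ^ L` by `2 ^ L` image of scale `ℓ`
(`pixelValue_add`), and all averages over the torus are translation invariant, so `S ℓ - S (ℓ + L)`
is the mean variance of such an image: `GD₂(ℓ) = 2 (S ℓ - S (ℓ + L))` (`scaleGD_two_eq`). Merging
four pixels into one loses at least the variance carried by their four edges, which gives
`LD₂(ℓ) ≤ 4 (S ℓ - S (ℓ + 1))` (`scaleLD_two_le`). Telescoping, `∑_{m < L} LD₂(ℓ + m) ≤ 2 GD₂(ℓ)`,
and `∑_{ℓ < k} LD₂(ℓ) ≤ 4 (S 0 - S k) ≤ 1` because a variable with values in `[0,1]` has variance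
at most `1/4` (`meanSq_sub_le`).

Write `a ℓ = LD₂(ℓ)`. The hypothesis now says that the sum of `a` over a window of length `L` is at
most `2α = 1 + p + ⋯ + p ^ (L - 1)` times the first term of the window. By downward induction this
forces the tails of `a` to decay at rate `p` (`tail_succ_le`), and among sequences of mass `1` with
this property the sum of the square roots is largest for `a ℓ = (1 - p) p ^ ℓ`, where it is
`(1 + √p) / √(1 - p)` (`sum_sqrt_le`). Finally `LD₁(ℓ) ≤ √LD₂(ℓ)` by the Cauchy–Schwarz inequality
(`scaleLD_one_le_sqrt`).

The equation for `p` is that of a geometric sum, which increases strictly from `1` to `L` on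
`[0,1]`. Its root decreases in `L`, so `p ^ L` tends to `0` and `p` to `1 - 1 / (2α)`. -/

namespace ImageModel

noncomputable section

/-! ### Edges and averages over the torus -/

theorem card_horiz_eq_card_vert (n : ℕ) :
    #{e ∈ edges n n | e.1.1 = e.2.1} = #{e ∈ edges n n | ¬ e.1.1 = e.2.1} := by
  refine card_bij' (fun e _ => (e.1.swap, e.2.swap)) (fun e _ => (e.1.swap, e.2.swap))
    ?_ ?_ (fun _ _ => rfl) (fun _ _ => rfl)
  all_goals
    rintro ⟨⟨⟨a, ha⟩, ⟨b, hb⟩⟩, ⟨⟨c, hc⟩, ⟨d, hd⟩⟩⟩ h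
    simp only [mem_filter, mem_edges, Adjacent, Prod.mk_le_mk, Fin.mk_le_mk, Fin.mk.injEq,
      Prod.swap_prod_mk] at h ⊢
    omega

variable {N : ℕ} [NeZero N]

/-- The average of a function over all `N ^ 2` locations of the torus. -/
def torusAvg (f : ZMod N → ZMod N → ℝ) : ℝ :=
  (1 / (N : ℝ) ^ 2) * ∑ i : ZMod N, ∑ j : ZMod N, f i j

theorem torusAvg_shift (f : ZMod N → ZMod N → ℝ) (a b : ZMod N) :
    torusAvg (fun i j => f (i + a) (j + b)) = torusAvg f := by
  unfold torusAvg
  congr 1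
  rw [← Equiv.sum_comp (Equiv.addRight a) (fun i => ∑ j, f i j)]
  refine sum_congr rfl fun i _ => ?_
  exact Equiv.sum_comp (Equiv.addRight b) (fun j => f (i + a) j)

theorem torusAvg_add (f g : ZMod N → ZMod N → ℝ) :
    torusAvg (fun i j => f i j + g i j) = torusAvg f + torusAvg g := by
  simp only [torusAvg, sum_add_distrib, mul_add]

theorem torusAvg_sub (f g : ZMod N → ZMod N → ℝ) :
    torusAvg (fun i j => f i j - g i j) = torusAvg f - torusAvg g := by
  simp only [torusAvg, sum_sub_distrib, mul_sub]

theorem torusAvg_const_mul (c : ℝ) (f : ZMod N → ZMod N → ℝ) :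
    torusAvg (fun i j => c * f i j) = c * torusAvg f := by
  simp only [torusAvg, ← mul_sum]
  ring

theorem torusAvg_sum {ι : Type*} (s : Finset ι) (f : ι → ZMod N → ZMod N → ℝ) :
    torusAvg (fun i j => ∑ e ∈ s, f e i j) = ∑ e ∈ s, torusAvg (f e) := by
  simp only [torusAvg, ← mul_sum]
  congr 1
  rw [sum_comm (s := s)]
  exact sum_congr rfl fun i _ => sum_comm

theorem torusAvg_mono {f g : ZMod N → ZMod N → ℝ} (h : ∀ i j, f i j ≤ g i j) :
    torusAvg f ≤ torusAvg g :=
  mul_le_mul_of_nonneg_left (sum_le_sum fun i _ => sum_le_sum fun j _ => h i j) (by positivity)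

theorem torusAvg_const (c : ℝ) : torusAvg (fun _ _ : ZMod N => c) = c := by
  have : (N : ℝ) ≠ 0 := Nat.cast_ne_zero.mpr (NeZero.ne N)
  simp only [torusAvg, sum_const, card_univ, ZMod.card, nsmul_eq_mul]
  field_simp

/-- The variance of a function on the torus is nonnegative. -/
theorem sq_torusAvg_le (f : ZMod N → ZMod N → ℝ) :
    torusAvg f ^ 2 ≤ torusAvg (fun i j => f i j ^ 2) := by
  set m := torusAvg f with hm
  have h : torusAvg (fun i j => 2 * m * f i j - m ^ 2) ≤ torusAvg (fun i j => f i j ^ 2) :=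
    torusAvg_mono fun i j => by nlinarith [sq_nonneg (f i j - m)]
  rw [torusAvg_sub (fun i j => 2 * m * f i j) (fun _ _ => m ^ 2), torusAvg_const_mul,
    torusAvg_const, ← hm] at h
  nlinarith

/-! ### Local discrepancies -/

/-- The mean discrepancy, in `r`-th power, between horizontally neighbouring pixels of scale
`ℓ`. -/
def horizDisc (r : ℕ) (U : Environment N) (ℓ : ℕ) : ℝ :=
  torusAvg fun i j => |pixelValue U ℓ i j - pixelValue U ℓ i (j + ((2 ^ ℓ : ℕ) : ZMod N))| ^ r

/-- The mean discrepancy, in `r`-th power, between vertically neighbouring pixels of scale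
`ℓ`. -/
def vertDisc (r : ℕ) (U : Environment N) (ℓ : ℕ) : ℝ :=
  torusAvg fun i j => |pixelValue U ℓ i j - pixelValue U ℓ (i + ((2 ^ ℓ : ℕ) : ZMod N)) j| ^ r

/-- The mean square of the pixel values of scale `ℓ`. -/
def meanSq (U : Environment N) (ℓ : ℕ) : ℝ :=
  torusAvg fun i j => pixelValue U ℓ i j ^ 2

/-- Each edge contributes, after averaging over the locations, the horizontal or the vertical
discrepancy, by translation invariance; the two kinds of edges are equally many. -/
theorem scaleLD_eq (r : ℕ) (U : Environment N) {n : ℕ} (hn : 2 ≤ n) (ℓ : ℕ) :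
    scaleLD r U n ℓ = (horizDisc r U ℓ + vertDisc r U ℓ) / 2 := by
  have hE : ∀ e ∈ edges n n,
      torusAvg (fun i j => |(imageAt U n ℓ i j).value e.1 - (imageAt U n ℓ i j).value e.2| ^ r) =
        if e.1.1 = e.2.1 then horizDisc r U ℓ else vertDisc r U ℓ := by
    rintro ⟨⟨⟨a, ha⟩, ⟨b, hb⟩⟩, ⟨⟨c, hc⟩, ⟨d, hd⟩⟩⟩ h
    simp only [mem_edges, Adjacent, Prod.mk_le_mk, Fin.mk_le_mk, Fin.mk.injEq] at h ⊢
    split_ifs with hac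
    · obtain rfl : d = b + 1 := by omega
      subst hac
      refine Eq.trans ?_ (torusAvg_shift _ ((a * 2 ^ ℓ : ℕ) : ZMod N) ((b * 2 ^ ℓ : ℕ) : ZMod N))
      simp only [imageAt, Nat.succ_mul, Nat.cast_add, add_assoc]
    · obtain rfl : c = a + 1 := by omega
      obtain rfl : b = d := by omega
      refine Eq.trans ?_ (torusAvg_shift _ ((a * 2 ^ ℓ : ℕ) : ZMod N) ((b * 2 ^ ℓ : ℕ) : ZMod N))
      simp only [imageAt, Nat.succ_mul, Nat.cast_add, add_assoc]
  have hsplit := card_filter_add_card_filter_not (s := edges n n)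
    (fun e : (Fin n × Fin n) × (Fin n × Fin n) => e.1.1 = e.2.1)
  have hcard := card_horiz_eq_card_vert n
  have hpos : 0 < #{e ∈ edges n n | e.1.1 = e.2.1} := by
    refine card_pos.mpr ⟨((⟨0, by omega⟩, ⟨0, by omega⟩), (⟨0, by omega⟩, ⟨1, by omega⟩)), ?_⟩
    simp [mem_edges, Adjacent]
  have hLD : scaleLD r U n ℓ = (1 / (#(edges n n) : ℝ)) * ∑ e ∈ edges n n,
      torusAvg (fun i j =>
        |(imageAt U n ℓ i j).value e.1 - (imageAt U n ℓ i j).value e.2| ^ r) := by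
    rw [← torusAvg_sum, ← torusAvg_const_mul]
    rfl
  rw [hLD, sum_congr rfl hE, sum_ite, sum_const, sum_const, ← hsplit, ← hcard]
  have : (#{e ∈ edges n n | e.1.1 = e.2.1} : ℝ) ≠ 0 := by exact_mod_cast hpos.ne'
  simp only [nsmul_eq_mul, Nat.cast_add]
  field_simp
  ring

theorem scaleLD_nonneg (r : ℕ) (U : Environment N) (n ℓ : ℕ) : 0 ≤ scaleLD r U n ℓ := by
  unfold scaleLD localDisc
  positivity

theorem scaleLD_one_le_sqrt (U : Environment N) {n : ℕ} (hn : 2 ≤ n) (ℓ : ℕ) :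
    scaleLD 1 U n ℓ ≤ √(scaleLD 2 U n ℓ) := by
  refine Real.le_sqrt_of_sq_le ?_
  rw [scaleLD_eq 1 U hn, scaleLD_eq 2 U hn]
  have h : horizDisc 1 U ℓ ^ 2 ≤ horizDisc 2 U ℓ := by
    simpa only [horizDisc, pow_one] using sq_torusAvg_le (fun i j =>
      |pixelValue U ℓ i j - pixelValue U ℓ i (j + ((2 ^ ℓ : ℕ) : ZMod N))|)
  have v : vertDisc 1 U ℓ ^ 2 ≤ vertDisc 2 U ℓ := by
    simpa only [vertDisc, pow_one] using sq_torusAvg_le (fun i j =>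
      |pixelValue U ℓ i j - pixelValue U ℓ (i + ((2 ^ ℓ : ℕ) : ZMod N)) j|)
  nlinarith [sq_nonneg (horizDisc 1 U ℓ - vertDisc 1 U ℓ)]

/-! ### Global discrepancies as loss of mean square -/

theorem sum_range_mul_eq (g : ℕ → ℝ) (a b : ℕ) :
    ∑ x ∈ range (a * b), g x = ∑ s ∈ range a, ∑ u ∈ range b, g (s * b + u) := by
  induction a with
  | zero => simp
  | succ a ih => rw [Nat.succ_mul, sum_range_add, ih, sum_range_succ]

/-- A pixel of scale `ℓ + L` is the mean of the `2 ^ L` by `2 ^ L` pixels of scale `ℓ` that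
make it up. -/
theorem pixelValue_add {N : ℕ} (U : Environment N) (ℓ L : ℕ) (i j : ZMod N) :
    pixelValue U (ℓ + L) i j = (1 / (2 : ℝ) ^ (2 * L)) *
      ∑ s ∈ range (2 ^ L), ∑ t ∈ range (2 ^ L),
        pixelValue U ℓ (i + ((s * 2 ^ ℓ : ℕ) : ZMod N)) (j + ((t * 2 ^ ℓ : ℕ) : ZMod N)) := by
  have hpow : 2 ^ (ℓ + L) = 2 ^ L * 2 ^ ℓ := by rw [pow_add, mul_comm]
  unfold pixelValue
  simp only [← mul_sum]
  rw [← mul_assoc, hpow, sum_range_mul_eq]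
  congr 1
  · rw [mul_add, pow_add]
    field_simp
  refine sum_congr rfl fun s _ => ?_
  simp only [sum_range_mul_eq _ (2 ^ L) (2 ^ ℓ)]
  rw [sum_comm]
  refine sum_congr rfl fun t _ => sum_congr rfl fun u _ => sum_congr rfl fun v _ => ?_
  simp only [Nat.cast_add, add_assoc]

theorem sum_sum_sq_sub {ι : Type*} [Fintype ι] (x : ι → ℝ) :
    ∑ p, ∑ q, |x p - x q| ^ 2 =
      2 * Fintype.card ι * ∑ p, x p ^ 2 - 2 * (∑ p, x p) ^ 2 := by
  simp only [sq_abs, sub_sq, sum_add_distrib, sum_sub_distrib, sum_const, card_univ,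
    nsmul_eq_mul, ← mul_sum, ← sum_mul]
  ring

/-- The global discrepancy of an image is twice the variance of its pixels, and the mean of a
`2 ^ L` by `2 ^ L` image of scale `ℓ` is a pixel of scale `ℓ + L`. -/
theorem scaleGD_two_eq (U : Environment N) (L ℓ : ℕ) :
    scaleGD 2 U (2 ^ L) ℓ = 2 * (meanSq U ℓ - meanSq U (ℓ + L)) := by
  have hI : ∀ i j : ZMod N, globalDisc 2 (imageAt U (2 ^ L) ℓ i j) =
      2 / (2 : ℝ) ^ (2 * L) * ∑ p : Fin (2 ^ L) × Fin (2 ^ L),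
        (imageAt U (2 ^ L) ℓ i j).value p ^ 2 - 2 * pixelValue U (ℓ + L) i j ^ 2 := by
    intro i j
    have hm : ∑ p : Fin (2 ^ L) × Fin (2 ^ L), (imageAt U (2 ^ L) ℓ i j).value p =
        (2 : ℝ) ^ (2 * L) * pixelValue U (ℓ + L) i j := by
      rw [pixelValue_add, Fintype.sum_prod_type, ← mul_assoc, mul_one_div_cancel (by positivity),
        one_mul, sum_range]
      refine sum_congr rfl fun s _ => ?_
      rw [sum_range]
      rfl
    rw [globalDisc, sum_sum_sq_sub, hm, Fintype.card_prod, Fintype.card_fin]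
    push_cast
    field_simp
    ring
  have hp : ∀ p : Fin (2 ^ L) × Fin (2 ^ L),
      torusAvg (fun i j => (imageAt U (2 ^ L) ℓ i j).value p ^ 2) = meanSq U ℓ := fun p =>
    torusAvg_shift (fun i j => pixelValue U ℓ i j ^ 2) _ _
  change torusAvg (fun i j => globalDisc 2 (imageAt U (2 ^ L) ℓ i j)) = _
  simp only [hI]
  rw [torusAvg_sub (fun i j => 2 / (2 : ℝ) ^ (2 * L) * ∑ p, (imageAt U (2 ^ L) ℓ i j).value p ^ 2)
    (fun i j => 2 * pixelValue U (ℓ + L) i j ^ 2), torusAvg_const_mul, torusAvg_const_mul,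
    torusAvg_sum]
  simp only [hp, sum_const, card_univ, Fintype.card_prod, Fintype.card_fin, nsmul_eq_mul]
  rw [← meanSq]
  push_cast
  field_simp
  ring

/-- The variance lost in merging four pixels into one is at least the contribution of their four
edges; the two diagonals are dropped. -/
theorem scaleLD_two_le (U : Environment N) {n : ℕ} (hn : 2 ≤ n) (ℓ : ℕ) :
    scaleLD 2 U n ℓ ≤ 4 * (meanSq U ℓ - meanSq U (ℓ + 1)) := by
  set F := pixelValue U ℓ with hF
  set d : ZMod N := ((2 ^ ℓ : ℕ) : ZMod N) with hd
  have hmerge : ∀ i j : ZMod N, pixelValue U (ℓ + 1) i j =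
      (F i j + F i (j + d) + F (i + d) j + F (i + d) (j + d)) / 4 := by
    intro i j
    rw [pixelValue_add]
    simp only [mul_one, pow_one, sum_range_succ, range_zero, sum_empty, zero_add, zero_mul,
      one_mul, Nat.cast_zero, add_zero, ← hF, ← hd]
    ring
  have key : torusAvg (fun i j =>
      (|F i j - F i (j + d)| ^ 2 + |F (i + d) j - F (i + d) (j + d)| ^ 2
        + |F i j - F (i + d) j| ^ 2 + |F i (j + d) - F (i + d) (j + d)| ^ 2)
      + 16 * pixelValue U (ℓ + 1) i j ^ 2) ≤
      torusAvg (fun i j => 4 * (F i j ^ 2 + F i (j + d) ^ 2 + F (i + d) j ^ 2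
        + F (i + d) (j + d) ^ 2)) := by
    refine torusAvg_mono fun i j => ?_
    simp only [hmerge, sq_abs]
    nlinarith [sq_nonneg (F i j - F (i + d) (j + d)), sq_nonneg (F i (j + d) - F (i + d) j)]
  have h1 := torusAvg_shift (fun i j => |F i j - F i (j + d)| ^ 2) d 0
  have h2 := torusAvg_shift (fun i j => |F i j - F (i + d) j| ^ 2) 0 d
  have s1 := torusAvg_shift (fun i j => F i j ^ 2) 0 d
  have s2 := torusAvg_shift (fun i j => F i j ^ 2) d 0
  have s3 := torusAvg_shift (fun i j => F i j ^ 2) d d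
  simp only [add_zero] at h1 h2 s1 s2
  simp only [torusAvg_add, torusAvg_const_mul, h1, h2, s1, s2, s3] at key
  rw [scaleLD_eq 2 U hn, horizDisc, vertDisc, meanSq, meanSq]
  linarith

theorem sum_scaleLD_two_le (U : Environment N) {n : ℕ} (hn : 2 ≤ n) (ℓ L : ℕ) :
    ∑ m ∈ range L, scaleLD 2 U n (ℓ + m) ≤ 4 * (meanSq U ℓ - meanSq U (ℓ + L)) := by
  induction L with
  | zero => simp
  | succ L ih =>
    rw [sum_range_succ]
    have := scaleLD_two_le U hn (ℓ + L)
    rw [← add_assoc]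
    linarith

theorem torusAvg_pixelValue (U : Environment N) (ℓ : ℕ) :
    torusAvg (pixelValue U ℓ) = torusAvg U.intensity := by
  change torusAvg (fun i j => _ * _) = _
  rw [torusAvg_const_mul, torusAvg_sum]
  simp only [torusAvg_sum, torusAvg_shift, sum_const, card_range, nsmul_eq_mul]
  push_cast
  rw [mul_comm 2 ℓ, pow_mul]
  field_simp

/-- A variable with values in `[0,1]` has variance at most `1/4`. -/
theorem meanSq_sub_le (U : Environment N) (k : ℕ) : meanSq U 0 - meanSq U k ≤ 1 / 4 := by
  have h0 : meanSq U 0 ≤ torusAvg (pixelValue U 0) := torusAvg_mono fun i j => by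
    have := pixelValue_mem U 0 i j
    nlinarith [this.1, this.2]
  have hk : torusAvg (pixelValue U k) ^ 2 ≤ meanSq U k := sq_torusAvg_le _
  rw [torusAvg_pixelValue] at h0 hk
  nlinarith [sq_nonneg (torusAvg U.intensity - 1 / 2)]

end

end ImageModel

/-! ### Sequences with bounded window sums -/

/-- If every window of length `L` sums to at most `1 + p + ⋯ + p ^ (L - 1)` times its first term,
the tails decay at rate `p`. Going downwards in `i`, the tail beyond the window is already known to
be at most `p ^ (L - 1)` times the tail from `i + 1`. -/
theorem tail_succ_le {a : ℕ → ℝ} {p : ℝ} {L k : ℕ} (ha : ∀ i, 0 ≤ a i) (hp : 0 < p)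
    (hp1 : p < 1) (hL : 2 ≤ L)
    (hwin : ∀ i < k, ∑ m ∈ range L, a (i + m) ≤ (1 - p ^ L) / (1 - p) * a i) (i : ℕ) :
    ∑ j ∈ Ico (i + 1) k, a j ≤ p * ∑ j ∈ Ico i k, a j := by
  induction h : k - i using Nat.strong_induction_on generalizing i with
  | _ d ih =>
  rcases le_or_gt k i with hki | hik
  · simp [Ico_eq_empty_of_le hki, Ico_eq_empty_of_le (hki.trans (Nat.le_succ i))]
  obtain ⟨M, rfl⟩ : ∃ M, L = M + 1 := ⟨L - 1, by omega⟩
  have hfar : ∀ m, ∑ j ∈ Ico (i + 1 + m) k, a j ≤ p ^ m * ∑ j ∈ Ico (i + 1) k, a j := by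
    intro m
    induction m with
    | zero => simp
    | succ m ihm =>
      have h1 := ih (k - (i + 1 + m)) (by omega) (i + 1 + m) rfl
      calc _ ≤ p * ∑ j ∈ Ico (i + 1 + m) k, a j := h1
        _ ≤ p * (p ^ m * ∑ j ∈ Ico (i + 1) k, a j) := by gcongr
        _ = _ := by ring
  have hhead := sum_eq_sum_Ico_succ_bot hik a
  have hcover : ∑ j ∈ Ico i k, a j ≤
      ∑ m ∈ range (M + 1), a (i + m) + ∑ j ∈ Ico (i + 1 + M) k, a j := by
    have hw : ∑ m ∈ range (M + 1), a (i + m) = ∑ j ∈ Ico i (i + 1 + M), a j := by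
      rw [sum_Ico_eq_sum_range]
      congr 2
      omega
    rw [hw, ← sum_union (by
      rw [disjoint_left]
      intro x hx hx'
      simp only [mem_Ico] at hx hx'
      omega)]
    refine sum_le_sum_of_subset_of_nonneg (fun x hx => ?_) fun x _ _ => ha x
    simp only [mem_union, mem_Ico] at hx ⊢
    omega
  have hw := hwin i hik
  have hM : p ^ M < 1 := pow_lt_one₀ hp.le hp1 (by omega)
  have hc : (1 - p ^ (M + 1)) / (1 - p) * a i = a i + p * (1 - p ^ M) * a i / (1 - p) := by
    have : 1 - p ≠ 0 := by linarith
    field_simp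
    ring
  set T := ∑ j ∈ Ico (i + 1) k, a j with hT
  have hmain : (1 - p ^ M) * T ≤ (1 - p ^ M) * (p * a i / (1 - p)) := by
    have e : (1 - p ^ M) * (p * a i / (1 - p)) = p * (1 - p ^ M) * a i / (1 - p) := by ring
    linarith [hfar M]
  have hdiv := (le_div_iff₀ (by linarith)).mp (le_of_mul_le_mul_left hmain (by linarith))
  rw [hhead]
  linarith

/-- The value `C = (1 + √p) / √(1 - p)` satisfies `√(1 - p) + C √p = C`: splitting off the
fraction `1 - p` of a mass preserves the bound `C √T` on the sum of the square roots, and a larger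
fraction only helps. -/
theorem sqrt_add_le {p a T : ℝ} (hp : 0 < p) (hp1 : p < 1) (ha : 0 ≤ a) (hT : 0 ≤ T)
    (h : T ≤ p * (a + T)) :
    √a + (1 + √p) / √(1 - p) * √T ≤ (1 + √p) / √(1 - p) * √(a + T) := by
  have hq : 0 ≤ √p := Real.sqrt_nonneg p
  have hq1 : √p < 1 := (Real.sqrt_lt' one_pos).mpr (by simpa using hp1)
  have hqq : √p ^ 2 = p := Real.sq_sqrt hp.le
  have hs : √T ≤ √p * √(a + T) := by
    rw [← Real.sqrt_mul hp.le]
    exact Real.sqrt_le_sqrt h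
  have hss : √T ^ 2 = T := Real.sq_sqrt hT
  have hmm : √(a + T) ^ 2 = a + T := Real.sq_sqrt (add_nonneg ha hT)
  have hm0 : 0 ≤ √(a + T) := Real.sqrt_nonneg _
  have hC : ((1 + √p) / √(1 - p)) ^ 2 = (1 + √p) / (1 - √p) := by
    rw [div_pow, Real.sq_sqrt (by linarith), div_eq_div_iff (by linarith) (by linarith)]
    linear_combination -(1 + √p) * hqq
  have hC0 : 0 ≤ (1 + √p) / √(1 - p) := by positivity
  set C := (1 + √p) / √(1 - p)
  set s := √T
  set m := √(a + T)
  have hsm : s ≤ m := hs.trans (by nlinarith)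
  suffices √a ≤ C * (m - s) by linarith
  refine Real.sqrt_le_iff.mpr ⟨mul_nonneg hC0 (by linarith), ?_⟩
  rw [mul_pow, hC, div_mul_eq_mul_div, le_div_iff₀ (by linarith)]
  have e : a = (m - s) * (m + s) := by linarith
  have : 0 ≤ (m - s) * (√p * m - s) := mul_nonneg (by linarith) (by linarith)
  rw [e]
  linarith

/-- With total mass at most `1` the bound is the sum of `√((1 - p) * p ^ i)` over all `i`, which the
geometric sequence attains. -/
theorem sum_sqrt_le {a : ℕ → ℝ} {p : ℝ} {L k : ℕ} (ha : ∀ i, 0 ≤ a i) (hp : 0 < p)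
    (hp1 : p < 1) (hL : 2 ≤ L)
    (hwin : ∀ i < k, ∑ m ∈ range L, a (i + m) ≤ (1 - p ^ L) / (1 - p) * a i) :
    ∑ j ∈ range k, √(a j) ≤ (1 + √p) / √(1 - p) * √(∑ j ∈ range k, a j) := by
  have key : ∀ i ≤ k,
      ∑ j ∈ Ico i k, √(a j) ≤ (1 + √p) / √(1 - p) * √(∑ j ∈ Ico i k, a j) := by
    intro i hi
    induction hi using Nat.decreasingInduction with
    | self => simp
    | of_succ i hik ih =>
      have htail := tail_succ_le ha hp hp1 hL hwin i
      rw [sum_eq_sum_Ico_succ_bot hik] at htail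
      rw [sum_eq_sum_Ico_succ_bot hik, sum_eq_sum_Ico_succ_bot hik]
      exact (add_le_add_right ih _).trans
        (sqrt_add_le hp hp1 (ha i) (sum_nonneg fun j _ => ha j) htail)
  simpa only [range_eq_Ico] using key 0 (Nat.zero_le k)

/-! ### The equation for the ratio -/

theorem one_sub_pow_div (p : ℝ) (hp1 : p < 1) (L : ℕ) :
    (1 - p ^ L) / (1 - p) = ∑ i ∈ range L, p ^ i := by
  rw [div_eq_iff (by linarith), mul_comm, mul_neg_geom_sum]

theorem geom_sum_lt_geom_sum {p q : ℝ} (hp : 0 ≤ p) (hpq : p < q) {L : ℕ} (hL : 2 ≤ L) :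
    ∑ i ∈ range L, p ^ i < ∑ i ∈ range L, q ^ i :=
  sum_lt_sum (fun i _ => pow_le_pow_left₀ hp hpq.le i)
    ⟨1, mem_range.mpr (by omega), by simpa using hpq⟩

theorem existsUnique_ratio {c : ℝ} {L : ℕ} (hc : 1 < c) (hcL : c < L) :
    ∃! p : ℝ, 0 < p ∧ p < 1 ∧ (1 - p ^ L) / (1 - p) = c := by
  have hL : 2 ≤ L := by
    have : (1 : ℝ) < L := hc.trans hcL
    exact_mod_cast this
  have hcont : ContinuousOn (fun p : ℝ => ∑ i ∈ range L, p ^ i) (Set.Icc 0 1) := by fun_prop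
  have hmem : c ∈ Set.Ioo (∑ i ∈ range L, (0 : ℝ) ^ i) (∑ i ∈ range L, (1 : ℝ) ^ i) := by
    constructor
    · obtain ⟨M, rfl⟩ : ∃ M, L = M + 1 := ⟨L - 1, by omega⟩
      simpa [sum_range_succ'] using hc
    · simpa using hcL
  obtain ⟨p, ⟨hp, hp1⟩, hpc⟩ := intermediate_value_Ioo zero_le_one hcont hmem
  refine ⟨p, ⟨hp, hp1, (one_sub_pow_div p hp1 L).trans hpc⟩, ?_⟩
  rintro q ⟨hq, hq1, hqc⟩
  rw [one_sub_pow_div q hq1] at hqc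
  rcases lt_trichotomy q p with h | h | h
  · exact absurd (hqc.trans hpc.symm) (geom_sum_lt_geom_sum hq.le h hL).ne
  · exact h
  · exact absurd (hqc.trans hpc.symm) (geom_sum_lt_geom_sum hp.le h hL).ne'

/-- The ratios decrease in `L`, so they stay away from `1` and `p L ^ L` vanishes in the limit. -/
theorem tendsto_ratio {c : ℝ} (hc : 1 < c) {p : ℕ → ℝ}
    (hp : ∀ L : ℕ, c < L → 0 < p L ∧ p L < 1 ∧ (1 - p L ^ L) / (1 - p L) = c) :
    Tendsto p atTop (𝓝 (1 - 1 / c)) := by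
  obtain ⟨L₀, hL₀⟩ := exists_nat_gt c
  have hL₀' : 2 ≤ L₀ := by
    have : (1 : ℝ) < L₀ := hc.trans hL₀
    exact_mod_cast this
  obtain ⟨hr, hr1, hrc⟩ := hp L₀ hL₀
  rw [one_sub_pow_div _ hr1] at hrc
  have hge : ∀ L ≥ L₀, 0 < p L ∧ p L < 1 ∧ (1 - p L ^ L) / (1 - p L) = c := fun L hL =>
    hp L (hL₀.trans_le (by exact_mod_cast hL))
  have hle : ∀ L ≥ L₀, p L ≤ p L₀ := by
    intro L hL
    obtain ⟨h0, h1, h⟩ := hge L hL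
    rw [one_sub_pow_div _ h1] at h
    by_contra! hlt
    have h2 := geom_sum_lt_geom_sum hr.le hlt hL₀'
    have h3 : ∑ i ∈ range L₀, p L ^ i ≤ ∑ i ∈ range L, p L ^ i :=
      sum_le_sum_of_subset_of_nonneg (range_mono hL) fun i _ _ => by positivity
    linarith
  have hpow : Tendsto (fun L => p L ^ L) atTop (𝓝 0) := by
    refine tendsto_of_tendsto_of_tendsto_of_le_of_le' tendsto_const_nhds
      (tendsto_pow_atTop_nhds_zero_of_lt_one hr.le hr1) ?_ ?_
    · filter_upwards [eventually_ge_atTop L₀] with L hL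
      have := (hge L hL).1
      positivity
    · filter_upwards [eventually_ge_atTop L₀] with L hL
      exact pow_le_pow_left₀ (hge L hL).1.le (hle L hL) L
  have hlim : Tendsto (fun L => 1 - (1 - p L ^ L) / c) atTop (𝓝 (1 - (1 - 0) / c)) :=
    tendsto_const_nhds.sub ((tendsto_const_nhds.sub hpow).div_const c)
  rw [sub_zero] at hlim
  refine hlim.congr' ?_
  filter_upwards [eventually_ge_atTop L₀] with L hL
  obtain ⟨h0, h1, h⟩ := hge L hL
  have : 1 - p L ≠ 0 := by linarith
  rw [div_eq_iff this] at h
  rw [h]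
  field_simp
  ring

theorem bound_at_limit_ratio {c : ℝ} (hc : 1 < c) :
    (1 + √(1 - 1 / c)) / √(1 - (1 - 1 / c)) = √c + √(c - 1) := by
  have h0 : 0 < c := by linarith
  have h1 : √(1 - (1 - 1 / c)) = 1 / √c := by
    rw [sub_sub_cancel, Real.sqrt_div zero_le_one, Real.sqrt_one]
  have h2 : √(1 - 1 / c) * √c = √(c - 1) := by
    rw [← Real.sqrt_mul' _ h0.le]
    congr 1
    field_simp
  rw [h1, div_div_eq_mul_div, div_one, add_mul, one_mul, h2]

theorem theorem2 (α : ℝ) (hα : 1 < α) :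
    -- the equation for `p` has exactly one solution (here `L = log₂ n`)
    (∀ L : ℕ, α < (L : ℝ) / 2 →
      ∃! p : ℝ, 0 < p ∧ p < 1 ∧ (1 - p ^ L) / (1 - p) = 2 * α) ∧
    -- the bounds on the linear local discrepancy
    (∀ (L n k N : ℕ) [NeZero N] (U : Environment N),
      n = 2 ^ L → 1 ≤ k → n * 2 ^ k ≤ N → α < (L : ℝ) / 2 →
      (∀ ℓ : ℕ, ℓ < k → scaleGD 2 U n ℓ ≤ α * scaleLD 2 U n ℓ) →
      ∀ p : ℝ, 0 < p → p < 1 → (1 - p ^ L) / (1 - p) = 2 * α →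
        (∑ ℓ ∈ Finset.range k, scaleLD 1 U n ℓ ≤ (1 + √p) / √(1 - p)) ∧
        avgLD 1 U n k ≤ ((1 + √p) / √(1 - p)) / (k : ℝ)) ∧
    -- the limit of the bound as `n = 2 ^ L` grows
    (∀ p : ℕ → ℝ,
      (∀ L : ℕ, α < (L : ℝ) / 2 →
        0 < p L ∧ p L < 1 ∧ (1 - p L ^ L) / (1 - p L) = 2 * α) →
      ∀ k : ℕ, 1 ≤ k →
        Tendsto (fun L : ℕ => ((1 + √(p L)) / √(1 - p L)) / (k : ℝ)) atTop
          (𝓝 ((√(2 * α) + √(2 * α - 1)) / (k : ℝ)))) := by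
  refine ⟨fun L hL => existsUnique_ratio (by linarith) (by linarith), ?_, ?_⟩
  · rintro L n k N _ U rfl - - hL hGD p hp hp1 hpα
    have hL2 : 2 ≤ L := by
      have : (1 : ℝ) < L := by linarith
      exact_mod_cast this
    have hn : 2 ≤ 2 ^ L := Nat.le_self_pow (by omega) 2
    have hwin : ∀ i < k, ∑ m ∈ Finset.range L, scaleLD 2 U (2 ^ L) (i + m) ≤
        (1 - p ^ L) / (1 - p) * scaleLD 2 U (2 ^ L) i := by
      intro i hi
      have h1 := hGD i hi
      rw [scaleGD_two_eq] at h1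
      have h2 := sum_scaleLD_two_le U hn i L
      rw [hpα]
      linarith
    have htotal : ∑ i ∈ Finset.range k, scaleLD 2 U (2 ^ L) i ≤ 1 := by
      have h1 := sum_scaleLD_two_le U hn 0 k
      have h2 := meanSq_sub_le U k
      simp only [zero_add] at h1
      linarith
    have hbound : ∑ i ∈ Finset.range k, scaleLD 1 U (2 ^ L) i ≤ (1 + √p) / √(1 - p) :=
      calc ∑ i ∈ Finset.range k, scaleLD 1 U (2 ^ L) i
          ≤ ∑ i ∈ Finset.range k, √(scaleLD 2 U (2 ^ L) i) :=
            Finset.sum_le_sum fun i _ => scaleLD_one_le_sqrt U hn i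
        _ ≤ (1 + √p) / √(1 - p) * √(∑ i ∈ Finset.range k, scaleLD 2 U (2 ^ L) i) :=
            sum_sqrt_le (fun i => scaleLD_nonneg 2 U _ i) hp hp1 hL2 hwin
        _ ≤ (1 + √p) / √(1 - p) :=
            mul_le_of_le_one_right (by positivity) (Real.sqrt_le_one.mpr htotal)
    have havg : avgLD 1 U (2 ^ L) k = (∑ i ∈ Finset.range k, scaleLD 1 U (2 ^ L) i) / k := by
      simp only [avgLD, scaleLD, ← Finset.mul_sum]
      ring
    refine ⟨hbound, ?_⟩
    rw [havg]
    gcongr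
  · intro p hp k _
    have hc : 1 < 2 * α := by linarith
    have hlim := tendsto_ratio hc fun L hL => hp L (by linarith)
    rw [← bound_at_limit_ratio hc]
    refine Tendsto.div_const (Tendsto.div (hlim.sqrt.const_add 1)
      (hlim.const_sub 1).sqrt ?_) _
    rw [sub_sub_cancel]
    positivity
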